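/- A stochastic combinatorial semi-bandit consists of a ground set $E=\{1,\dots,L\}$, a non-empty family $\Theta\subseteq 2^E$ of feasible sets (solutions), and a probability distribution $P$ on $[0,1]^E$. Assume that every item $e\in E$ belongs to at least one solution. Write $f(A,w)=\sum_{e\in A}w(e)$, $K=\max_{A\in\Theta}|A|$, $\bar w=\mathbb E_{w\sim P}[w]$, let $A^\ast\in\arg\max_{A\in\Theta}f(A,\bar w)$ be an optimal solution, and let $\Delta_A=f(A^\ast,\bar w)-f(A,\bar w)$ be the gap of $A\in\Theta$. Let $w_1,w_2,\dots$ be i.i.d. with distribution $P$; at step $t$ a solution $A_t$ is chosen and the weights $w_t(e)$, $e\in A_t$, are observed. An oracle is a measurable map that sends each weight vector $v\in\mathbb R^E$ to an element of $\arg\max_{A\in\Theta}f(A,v)$. Given an oracle, the algorithm CombUCB1 runs as follows. *Initialization.* Start with $u(e)=1$ and $\hat w(e)=0$ for all $e$. While $u(e)=1$ for some $e$: choose $A_t$ as the oracle's answer on $u$ and, for all $e\in A_t$, set $\hat w(e)\leftarrow w_t(e)$ and $u(e)\leftarrow 0$. Let $t_0$ be the first step after the initialization and put $T(e)=1$ for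 all $e\in E$. *Steps $t\ge t_0$.* Choose $A_t$ as the oracle's answer on the vector $U_t(e)=\hat w(e)+\sqrt{1.5\log(t-1)/T(e)}$; then, for all $e\in A_t$, replace $\hat w(e)$ by $\bigl(T(e)\hat w(e)+w_t(e)\bigr)/(T(e)+1)$ and $T(e)$ by $T(e)+1$. The expected cumulative regret in $n$ steps (initialization steps included) is $R(n)=\mathbb E\bigl[\sum_{t=1}^n\bigl(f(A^\ast,w_t)-f(A_t,w_t)\bigr)\bigr]$. **Theorem.** Let $\Delta>0$ and suppose that $\Delta_A=\Delta$ for every solution $A$ that is not optimal. Then for every oracle and every $n\ge 1$, the expectation defining the regret $R(n)$ of CombUCB1 exists and $$R(n)\le KL\,\frac{267}{\Delta}\log n+\left(\frac{\pi^2}{3}+1\right)KL .$$ -/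

import Mathlib

open MeasureTheory ProbabilityTheory

namespace CombSemiBandit

/-- A stochastic combinatorial semi-bandit `(E, Θ, P)` with ground set `E = Fin L`: a nonempty
family `Θ` of feasible subsets of `E` and a probability distribution `P` on the cube `[0,1]^E`. -/
structure SemiBandit (L : ℕ) where
  /-- The feasible set `Θ`; its members are the solutions. -/
  feasible : Finset (Finset (Fin L))
  feasible_nonempty : feasible.Nonempty
  /-- The distribution `P` of the weights. -/
  law : Measure (Fin L → unitInterval)
  isProbabilityMeasure_law : IsProbabilityMeasure law

/-- The return `f(A, w) = ∑ e ∈ A, w e`. -/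
def ret {L : ℕ} (A : Finset (Fin L)) (w : Fin L → ℝ) : ℝ :=
  ∑ e ∈ A, w e

namespace SemiBandit

variable {L : ℕ} (B : SemiBandit L)

/-- The maximum number of chosen items, `K = max_{A ∈ Θ} |A|`. -/
def maxCard : ℕ :=
  B.feasible.sup Finset.card

/-- The expected weight of the item `e`. -/
noncomputable def meanWeight (e : Fin L) : ℝ :=
  ∫ x, (x e : ℝ) ∂B.law

/-- `A` is an optimal solution: it maximizes the expected return over the feasible set. -/
def IsOptimal (A : Finset (Fin L)) : Prop :=
  A ∈ B.feasible ∧ ∀ A' ∈ B.feasible, ret A' B.meanWeight ≤ ret A B.meanWeight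

/-- The gap of the solution `A` relative to the optimal solution `Aopt`. -/
noncomputable def gap (Aopt A : Finset (Fin L)) : ℝ :=
  ret Aopt B.meanWeight - ret A B.meanWeight

end SemiBandit

/-- An offline optimization oracle for the feasible set `Θ`: a (measurable) map that sends every
weight vector to a solution of maximal return, ties being broken in an arbitrary fixed way. -/
structure IsOracle {L : ℕ} (Θ : Finset (Finset (Fin L)))
    (oracle : (Fin L → ℝ) → Finset (Fin L)) : Prop where
  mem : ∀ v, oracle v ∈ Θ
  ret_le : ∀ v, ∀ A ∈ Θ, ret A v ≤ ret (oracle v) v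
  measurableSet_eq : ∀ A, MeasurableSet {v | oracle v = A}

/-- The variables of CombUCB1 between two steps. -/
structure State (L : ℕ) where
  /-- The auxiliary weights of the initialization; `u e = 1` as long as `e` is unobserved. -/
  u : Fin L → ℝ
  /-- The observation counters. -/
  T : Fin L → ℕ
  /-- The averages of the observed weights. -/
  wHat : Fin L → ℝ

namespace State

variable {L : ℕ}

/-- The variables before the first step. The counters are set to `1` at the end of the
initialization and are not used before, so that they can be set to `1` from the start. -/
def start (L : ℕ) : State L where
  u := fun _ => 1
  T := fun _ => 1
  wHat := fun _ => 0

/-- The initialization is still running. -/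
def Initializing (s : State L) : Prop :=
  ∃ e, s.u e = 1

/-- The confidence radius `c_{t,s} = √(1.5 log t / s)`. -/
noncomputable def radius (t s : ℕ) : ℝ :=
  Real.sqrt (1.5 * Real.log t / s)

/-- The upper confidence bounds `U_{t+1}` at step `t + 1`, that is, after `t` steps. -/
noncomputable def ucb (t : ℕ) (s : State L) (e : Fin L) : ℝ :=
  s.wHat e + radius t (s.T e)

open Classical in
/-- The solution `A_{t+1}` chosen at step `t + 1`, from the variables after `t` steps. -/
noncomputable def choice (oracle : (Fin L → ℝ) → Finset (Fin L)) (t : ℕ) (s : State L) :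
    Finset (Fin L) :=
  if s.Initializing then oracle s.u else oracle (s.ucb t)

open Classical in
/-- The update of the variables after the solution `A` is chosen and the weights `x e`, `e ∈ A`,
are observed. During the initialization the estimate of each observed item is replaced by the
observed weight; later on the running averages and the counters are updated. -/
noncomputable def update (s : State L) (A : Finset (Fin L)) (x : Fin L → ℝ) : State L :=
  if s.Initializing then
    { u := fun e => if e ∈ A then 0 else s.u e
      T := s.T
      wHat := fun e => if e ∈ A then x e else s.wHat e }
  else
    { u := s.u
      T := fun e => if e ∈ A then s.T e + 1 else s.T e
      wHat := fun e =>
        if e ∈ A then (s.T e * s.wHat e + x e) / ((s.T e + 1 : ℕ) : ℝ) else s.wHat e }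

end State

/-- The variables of CombUCB1 after `t` steps, when `w k` is the weight vector at step `k + 1`. -/
noncomputable def run {L : ℕ} (oracle : (Fin L → ℝ) → Finset (Fin L)) (w : ℕ → Fin L → ℝ) :
    ℕ → State L
  | 0 => State.start L
  | t + 1 => (run oracle w t).update ((run oracle w t).choice oracle t) (w t)

/-- The solution `A_{t+1}` that CombUCB1 chooses at step `t + 1`. -/
noncomputable def chosen {L : ℕ} (oracle : (Fin L → ℝ) → Finset (Fin L)) (w : ℕ → Fin L → ℝ)
    (t : ℕ) : Finset (Fin L) :=
  (run oracle w t).choice oracle t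

/-- The cumulative regret `∑ (f(A*, w_t) - f(A_t, w_t))` of the first `n` steps of CombUCB1
(initialization included) along the weight sequence `w`, relative to the solution `Aopt = A*`. -/
noncomputable def cumRegret {L : ℕ} (oracle : (Fin L → ℝ) → Finset (Fin L))
    (Aopt : Finset (Fin L)) (w : ℕ → Fin L → ℝ) (n : ℕ) : ℝ :=
  ∑ t ∈ Finset.range n, (ret Aopt (w t) - ret (chosen oracle w t) (w t))

end CombSemiBandit

/-! The choice at a step depends only on earlier weights, so the expected regret is the expected sum
of the gaps of the chosen solutions (`integral_cumRegret`). Each gap is at most `K`, and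
`gap_chosen_le` charges it to one of three accounts.

Initialization: its schedule does not depend on the weights and every step of it observes a new
item, so it lasts at most `L` steps and costs at most `K * L`.

Invalid confidence intervals: for a fixed `l`, the potential `exp (l * T * (wHat - v) - l ^ 2 * T /
8)` has expectation at most `1`, by Hoeffding's lemma and independence. Markov's inequality and a
union bound over the values of the counter give failure probability at most `2 / t ^ 2` per item,
hence `π ^ 2 / 3` after summation over time.

Valid intervals and a suboptimal choice: optimism gives `Δ ≤ 2 * ∑ radius`. Doubling this and
subtracting `Δ` gives `Δ ≤ ∑ (4 * radius - Δ / K)`, where only the positive parts are kept. These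
vanish for large counters, and each item meets each counter value at most once, so an item pays at
most `∑ s, (4 * √(C / s) - Δ / K)⁺ ≤ 32 * C * K / Δ` with `C = 1.5 * log n`. The resulting constant
is `48`, below the required `267`. -/

namespace CombSemiBandit

/-! ### The deterministic initialization phase -/

section Initialization

variable {L : ℕ} (oracle : (Fin L → ℝ) → Finset (Fin L))

open Classical in
/-- The auxiliary weights `u` after `t` steps. They do not depend on the observed weights. -/
noncomputable def initWeights : ℕ → Fin L → ℝ
  | 0 => fun _ => 1
  | t + 1 =>
    if ∃ e, initWeights t e = 1 then
      fun e => if e ∈ oracle (initWeights t) then 0 else initWeights t e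
    else initWeights t

/-- Step `t + 1` belongs to the initialization. -/
def InitAt (t : ℕ) : Prop :=
  ∃ e, initWeights oracle t e = 1

theorem run_u (w : ℕ → Fin L → ℝ) (t : ℕ) : (run oracle w t).u = initWeights oracle t := by
  induction t with
  | zero => rfl
  | succ t ih =>
    have h : (run oracle w t).Initializing ↔ ∃ e, initWeights oracle t e = 1 := by
      rw [State.Initializing, ih]
    by_cases hi : (run oracle w t).Initializing
    · have hi' := h.1 hi
      simp only [run, State.update, State.choice, if_pos hi, initWeights, if_pos hi', ih]
    · have hi' := mt h.2 hi
      simp only [run, State.update, if_neg hi, initWeights, if_neg hi', ih]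

theorem initializing_run_iff (w : ℕ → Fin L → ℝ) (t : ℕ) :
    (run oracle w t).Initializing ↔ InitAt oracle t := by
  rw [State.Initializing, run_u, InitAt]

theorem initWeights_eq_zero_or_one (t : ℕ) (e : Fin L) :
    initWeights oracle t e = 0 ∨ initWeights oracle t e = 1 := by
  induction t with
  | zero => exact Or.inr rfl
  | succ t ih =>
    rw [initWeights]
    split_ifs with h
    · by_cases he : e ∈ oracle (initWeights oracle t)
      · simp [he]
      · simpa [he] using ih
    · exact ih

variable {oracle}

/-- Every step of the initialization observes an item for the first time. -/
theorem exists_mem_oracle_initWeights {Θ : Finset (Finset (Fin L))} (horacle : IsOracle Θ oracle)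
    (hcover : ∀ e : Fin L, ∃ A ∈ Θ, e ∈ A) {t : ℕ} (ht : InitAt oracle t) :
    ∃ e ∈ oracle (initWeights oracle t), initWeights oracle t e = 1 := by
  obtain ⟨e, he⟩ := ht
  obtain ⟨A, hA, heA⟩ := hcover e
  have hnonneg : ∀ i, 0 ≤ initWeights oracle t i := fun i => by
    rcases initWeights_eq_zero_or_one oracle t i with h | h <;> simp [h]
  -- A solution through an unobserved item returns at least `1`, whereas an oracle answer made of
  -- observed items only would return `0`.
  have h1 : 1 ≤ ret A (initWeights oracle t) := by
    rw [← he]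
    exact Finset.single_le_sum (fun i _ => hnonneg i) heA
  have h2 := h1.trans (horacle.ret_le (initWeights oracle t) A hA)
  by_contra! hne
  have : ret (oracle (initWeights oracle t)) (initWeights oracle t) = 0 :=
    Finset.sum_eq_zero fun i hi =>
      (initWeights_eq_zero_or_one oracle t i).resolve_right (hne i hi)
  linarith

open Classical in
theorem card_filter_initAt_le {Θ : Finset (Finset (Fin L))} (horacle : IsOracle Θ oracle)
    (hcover : ∀ e : Fin L, ∃ A ∈ Θ, e ∈ A) (n : ℕ) :
    ((Finset.range n).filter (InitAt oracle)).card ≤ L := by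
  -- Adding the number of unobserved items makes the bound inductive: each initialization step
  -- lowers that number by at least one.
  suffices h : ((Finset.range n).filter (InitAt oracle)).card
      + (Finset.univ.filter fun e => initWeights oracle n e = 1).card ≤ L by omega
  induction n with
  | zero => simpa using Finset.card_filter_le (Finset.univ : Finset (Fin L)) _
  | succ n ih =>
    rw [Finset.range_add_one, Finset.filter_insert]
    by_cases hi : InitAt oracle n
    · rw [if_pos hi, Finset.card_insert_of_notMem (by simp)]
      have hlt : (Finset.univ.filter fun e => initWeights oracle (n + 1) e = 1).card
          < (Finset.univ.filter fun e => initWeights oracle n e = 1).card := by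
        obtain ⟨e, heA, he⟩ := exists_mem_oracle_initWeights horacle hcover hi
        have hi' : ∃ e, initWeights oracle n e = 1 := hi
        apply Finset.card_lt_card
        rw [Finset.ssubset_iff_of_subset]
        · exact ⟨e, by simpa using he, by simp [initWeights, if_pos hi', heA]⟩
        · intro i
          simp only [Finset.mem_filter, Finset.mem_univ, true_and, initWeights, if_pos hi']
          split_ifs <;> simp
      omega
    · have hi' : ¬ ∃ e, initWeights oracle n e = 1 := hi
      simpa only [if_neg hi, initWeights, if_neg hi'] using ih

end Initialization

/-! ### Counters and optimism along a fixed weight sequence -/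

section Path

variable {L : ℕ} {oracle : (Fin L → ℝ) → Finset (Fin L)} {w : ℕ → Fin L → ℝ} {t : ℕ}

theorem chosen_of_initAt (h : InitAt oracle t) :
    chosen oracle w t = oracle (initWeights oracle t) := by
  rw [chosen, State.choice, if_pos ((initializing_run_iff oracle w t).2 h), run_u]

theorem chosen_of_not_initAt (h : ¬ InitAt oracle t) :
    chosen oracle w t = oracle ((run oracle w t).ucb t) := by
  rw [chosen, State.choice, if_neg (mt (initializing_run_iff oracle w t).1 h)]

theorem chosen_mem {Θ : Finset (Finset (Fin L))} (horacle : IsOracle Θ oracle) :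
    chosen oracle w t ∈ Θ := by
  rw [chosen, State.choice]
  split_ifs
  exacts [horacle.mem _, horacle.mem _]

theorem run_succ_of_initAt (h : InitAt oracle t) :
    run oracle w (t + 1) =
      { u := initWeights oracle (t + 1)
        T := (run oracle w t).T
        wHat := fun e => if e ∈ oracle (initWeights oracle t) then w t e
          else (run oracle w t).wHat e } := by
  have hr := (initializing_run_iff oracle w t).2 h
  rw [← run_u oracle w (t + 1), ← chosen_of_initAt (w := w) h]
  simp only [run, State.update, if_pos hr, chosen]
  congr!

theorem run_succ_of_not_initAt (h : ¬ InitAt oracle t) :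
    run oracle w (t + 1) =
      { u := initWeights oracle (t + 1)
        T := fun e => if e ∈ chosen oracle w t then (run oracle w t).T e + 1
          else (run oracle w t).T e
        wHat := fun e => if e ∈ chosen oracle w t then
            ((run oracle w t).T e * (run oracle w t).wHat e + w t e)
              / (((run oracle w t).T e + 1 : ℕ) : ℝ)
          else (run oracle w t).wHat e } := by
  have hr := mt (initializing_run_iff oracle w t).1 h
  rw [← run_u oracle w (t + 1)]
  simp only [run, State.update, if_neg hr, chosen]
  congr!

theorem one_le_run_T (e : Fin L) : 1 ≤ (run oracle w t).T e := by
  induction t with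
  | zero => exact le_rfl
  | succ t ih =>
    by_cases h : InitAt oracle t
    · rwa [run_succ_of_initAt h]
    · rw [run_succ_of_not_initAt h]
      dsimp only
      split_ifs <;> omega

theorem run_T_le (ht : 1 ≤ t) (e : Fin L) : (run oracle w t).T e ≤ t := by
  induction t, ht using Nat.le_induction with
  | base =>
    -- The existence of an item makes step one an initialization step, which leaves the counters at
    -- `1`.
    have h : InitAt oracle 0 := ⟨e, rfl⟩
    rw [run_succ_of_initAt h]
    exact le_rfl
  | succ t _ ih =>
    by_cases h : InitAt oracle t
    · rw [run_succ_of_initAt h]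
      exact ih.trans t.le_succ
    · rw [run_succ_of_not_initAt h]
      dsimp only
      split_ifs <;> omega

open Classical in
/-- After the initialization each item is observed at most once per value of its counter. -/
theorem sum_sum_chosen_le {g : ℕ → ℝ} (n : ℕ) :
    ∑ t ∈ Finset.range n,
        (if InitAt oracle t then 0
          else ∑ e ∈ chosen oracle w t, g ((run oracle w t).T e))
      = ∑ e, ∑ s ∈ Finset.Ico 1 ((run oracle w n).T e), g s := by
  induction n with
  | zero => simp [run, State.start]
  | succ n ih =>
    rw [Finset.sum_range_succ, ih]
    by_cases h : InitAt oracle n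
    · rw [if_pos h, add_zero, run_succ_of_initAt h]
    · rw [if_neg h, run_succ_of_not_initAt h, ← Finset.sum_ite_mem_eq (chosen oracle w n),
        ← Finset.sum_add_distrib]
      refine Finset.sum_congr rfl fun e _ => ?_
      dsimp only
      split_ifs
      · rw [Finset.sum_Ico_succ_top (one_le_run_T e)]
      · rw [add_zero]

/-- If all confidence intervals are valid, the gap of the chosen solution is at most twice the sum
of the confidence radii of its items. -/
theorem ret_sub_ret_chosen_le {Θ : Finset (Finset (Fin L))} (horacle : IsOracle Θ oracle)
    {A : Finset (Fin L)} (hA : A ∈ Θ) {v : Fin L → ℝ} (h : ¬ InitAt oracle t)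
    (hv : ∀ e, |(run oracle w t).wHat e - v e| ≤ State.radius t ((run oracle w t).T e)) :
    ret A v - ret (chosen oracle w t) v
      ≤ 2 * ∑ e ∈ chosen oracle w t, State.radius t ((run oracle w t).T e) := by
  have h1 : ret A v ≤ ret A ((run oracle w t).ucb t) :=
    Finset.sum_le_sum fun e _ => by
      have := (abs_le.1 (hv e)).1
      rw [State.ucb]
      linarith
  have h2 := horacle.ret_le ((run oracle w t).ucb t) A hA
  rw [← chosen_of_not_initAt (w := w) h] at h2
  have h3 : ret (chosen oracle w t) ((run oracle w t).ucb t) ≤ ret (chosen oracle w t) v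
      + 2 * ∑ e ∈ chosen oracle w t, State.radius t ((run oracle w t).T e) := by
    rw [ret, ret, Finset.mul_sum, ← Finset.sum_add_distrib]
    refine Finset.sum_le_sum fun e _ => ?_
    have := (abs_le.1 (hv e)).2
    rw [State.ucb]
    linarith
  linarith

end Path

/-! ### Summing truncated confidence radii over counter values -/

section Amortization

theorem sum_Icc_inv_sqrt_le (p : ℕ) : ∑ s ∈ Finset.Icc 1 p, (√(s : ℝ))⁻¹ ≤ 2 * √(p : ℝ) := by
  induction p with
  | zero => simp
  | succ p ih =>
    rw [Finset.sum_Icc_succ_top (by omega)]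
    set a := √(p : ℝ)
    set b := √((p + 1 : ℕ) : ℝ)
    have ha : 0 ≤ a := Real.sqrt_nonneg _
    have hb : 0 < b := Real.sqrt_pos.2 (by positivity)
    have hab : b ^ 2 = a ^ 2 + 1 := by
      rw [Real.sq_sqrt (by positivity), Real.sq_sqrt (by positivity)]
      push_cast
      ring
    have : b⁻¹ ≤ 2 * b - 2 * a := by
      rw [inv_le_iff_one_le_mul₀ hb]
      nlinarith [sq_nonneg (b - a)]
    linarith

/-- The positive part of an inflated confidence radius minus the threshold `d`. -/
noncomputable def excess (C d : ℝ) (s : ℕ) : ℝ :=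
  max 0 (4 * √(C / s) - d)

/-- The bound is uniform in `m` because a term vanishes once `4 * √(C / s) ≤ d`. For the remaining
`s` the `-d` is dropped and `∑ 1 / √s ≤ 2 * √p` is used. -/
theorem sum_excess_le {C d : ℝ} (hC : 0 ≤ C) (hd : 0 < d) (m : ℕ) :
    ∑ s ∈ Finset.Ico 1 m, excess C d s ≤ 32 * C / d := by
  -- The last counter value at which `4 * √(C / s) ≥ d` is possible.
  set p := ⌊16 * C / d ^ 2⌋₊
  have hterm : ∀ s ∈ Finset.Ico 1 m,
      excess C d s ≤ if s ≤ p then 4 * √C * (√(s : ℝ))⁻¹ else 0 := by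
    intro s hs
    have hs1 : (0 : ℝ) < s := by
      have := (Finset.mem_Ico.1 hs).1
      exact_mod_cast this
    split_ifs with h
    · refine max_le (by positivity) ?_
      rw [Real.sqrt_div hC, div_eq_mul_inv, ← mul_assoc]
      linarith
    · refine max_le le_rfl ?_
      have hlt : 16 * C / d ^ 2 < s := Nat.lt_of_floor_lt (not_le.1 h)
      have : √(C / s) ≤ d / 4 := by
        rw [Real.sqrt_le_left (by positivity), div_le_iff₀ hs1]
        rw [div_lt_iff₀ (by positivity)] at hlt
        linarith
      linarith
  calc ∑ s ∈ Finset.Ico 1 m, excess C d s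
      ≤ ∑ s ∈ Finset.Ico 1 m, if s ≤ p then 4 * √C * (√(s : ℝ))⁻¹ else 0 :=
        Finset.sum_le_sum hterm
    _ = ∑ s ∈ (Finset.Ico 1 m).filter (· ≤ p), 4 * √C * (√(s : ℝ))⁻¹ := by
        rw [Finset.sum_filter]
    _ ≤ ∑ s ∈ Finset.Icc 1 p, 4 * √C * (√(s : ℝ))⁻¹ := by
        refine Finset.sum_le_sum_of_subset_of_nonneg (fun s hs => ?_)
          fun s _ _ => by positivity
        simp only [Finset.mem_filter, Finset.mem_Ico, Finset.mem_Icc] at hs ⊢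
        omega
    _ ≤ 4 * √C * (2 * √(p : ℝ)) := by
        rw [← Finset.mul_sum]
        exact mul_le_mul_of_nonneg_left (sum_Icc_inv_sqrt_le p) (by positivity)
    _ ≤ 4 * √C * (2 * (4 * √C / d)) := by
        gcongr
        refine Real.sqrt_le_iff.2 ⟨by positivity, (Nat.floor_le (by positivity)).trans_eq ?_⟩
        rw [div_pow, mul_pow, Real.sq_sqrt hC]
        norm_num
    _ = 32 * C / d := by
        rw [show 4 * √C * (2 * (4 * √C / d)) = 32 * (√C * √C) / d by ring, Real.mul_self_sqrt hC]

end Amortization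

/-! ### Counters during the initialization -/

section Path

variable {L : ℕ} {oracle : (Fin L → ℝ) → Finset (Fin L)} {w : ℕ → Fin L → ℝ} {t : ℕ}

theorem InitAt.of_succ (h : InitAt oracle (t + 1)) : InitAt oracle t := by
  by_contra hn
  have hn' : ¬ ∃ e, initWeights oracle t e = 1 := hn
  rw [InitAt, initWeights, if_neg hn'] at h
  exact hn h

theorem run_T_of_initAt (h : InitAt oracle t) (e : Fin L) : (run oracle w t).T e = 1 := by
  induction t with
  | zero => rfl
  | succ t ih =>
    rw [run_succ_of_initAt h.of_succ]
    exact ih h.of_succ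

end Path

/-! ### Measurability and independence of the past -/

section Measurability

variable {L : ℕ} {Ω : Type*}

/-- The weight sequence along the sample point `ω`. -/
def path (w : ℕ → Ω → Fin L → unitInterval) (ω : Ω) : ℕ → Fin L → ℝ :=
  fun t e => (w t ω e : ℝ)

variable {w : ℕ → Ω → Fin L → unitInterval} {oracle : (Fin L → ℝ) → Finset (Fin L)}
  {Θ : Finset (Finset (Fin L))}

theorem measurable_path_apply [MeasurableSpace Ω] {t : ℕ} (hw : Measurable (w t)) (e : Fin L) :
    Measurable fun ω => path w ω t e :=
  measurable_subtype_coe.comp ((measurable_pi_apply e).comp hw)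

theorem IsOracle.measurableSet (horacle : IsOracle Θ oracle) (p : Finset (Fin L) → Prop) :
    MeasurableSet {v | p (oracle v)} := by
  have : {v | p (oracle v)} = ⋃ A ∈ {A | p A}, {v | oracle v = A} := by
    ext v
    simp
  rw [this]
  exact (Set.toFinite _).measurableSet_biUnion fun A _ => horacle.measurableSet_eq A

theorem measurableSet_chosen_of_run [MeasurableSpace Ω] (horacle : IsOracle Θ oracle) {t : ℕ}
    (h : ∀ e, Measurable (fun ω => (run oracle (path w ω) t).T e) ∧
      Measurable fun ω => (run oracle (path w ω) t).wHat e) (p : Finset (Fin L) → Prop) :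
    MeasurableSet {ω | p (chosen oracle (path w ω) t)} := by
  by_cases hi : InitAt oracle t
  · simp only [chosen_of_initAt hi, MeasurableSet.const]
  · simp only [chosen_of_not_initAt hi]
    have hu : Measurable fun ω => (run oracle (path w ω) t).ucb t := by
      refine measurable_pi_iff.2 fun e => (h e).2.add ?_
      exact (measurable_of_countable (State.radius t)).comp (h e).1
    exact hu (horacle.measurableSet p)

/-- The σ-algebra on `Ω` is arbitrary and only the weights of the first `t` steps are required to be
measurable. Taking `past w t` for it shows that the next choice is predictable. -/
theorem measurable_run [MeasurableSpace Ω] (horacle : IsOracle Θ oracle) {t : ℕ}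
    (hw : ∀ k < t, Measurable (w k)) (e : Fin L) :
    Measurable (fun ω => (run oracle (path w ω) t).T e) ∧
      Measurable fun ω => (run oracle (path w ω) t).wHat e := by
  induction t generalizing e with
  | zero => exact ⟨measurable_const, measurable_const⟩
  | succ t ih =>
    have ih' := ih fun k hk => hw k (hk.trans t.lt_succ_self)
    have hx := measurable_path_apply (hw t t.lt_succ_self) e
    have hT : Measurable fun ω => ((run oracle (path w ω) t).T e : ℝ) :=
      measurable_from_nat.comp (ih' e).1
    by_cases hi : InitAt oracle t
    · simp only [run_succ_of_initAt hi]
      refine ⟨(ih' e).1, ?_⟩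
      split_ifs
      exacts [hx, (ih' e).2]
    · simp only [run_succ_of_not_initAt hi]
      have hA := measurableSet_chosen_of_run horacle ih' (e ∈ ·)
      refine ⟨Measurable.ite hA ((ih' e).1.add_const 1) (ih' e).1,
        Measurable.ite hA (((hT.mul (ih' e).2).add hx).div ?_) (ih' e).2⟩
      push_cast
      exact hT.add_const 1

theorem measurableSet_chosen [MeasurableSpace Ω] (horacle : IsOracle Θ oracle) {t : ℕ}
    (hw : ∀ k < t, Measurable (w k)) (p : Finset (Fin L) → Prop) :
    MeasurableSet {ω | p (chosen oracle (path w ω) t)} :=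
  measurableSet_chosen_of_run horacle (measurable_run horacle hw) p

/-- The `σ`-algebra generated by the weights of the first `t` steps. -/
abbrev past (w : ℕ → Ω → Fin L → unitInterval) (t : ℕ) : MeasurableSpace Ω :=
  ⨆ k ∈ Set.Iio t, MeasurableSpace.comap (w k) inferInstance

theorem measurable_past {t k : ℕ} (hk : k < t) : Measurable[past w t] (w k) :=
  measurable_iff_comap_le.2 (le_iSup₂_of_le k hk le_rfl)

theorem past_le [mΩ : MeasurableSpace Ω] (hw : ∀ t, Measurable (w t)) (t : ℕ) : past w t ≤ mΩ :=
  iSup₂_le fun k _ => (hw k).comap_le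

/-- Indices start at `0`: `w t` is the weight vector of step `t + 1`, the first one not contained in
`past w t`. -/
theorem indep_past [MeasurableSpace Ω] {μ : Measure Ω} (hw : ∀ t, Measurable (w t))
    (hindep : iIndepFun w μ) (t : ℕ) :
    Indep (past w t) (MeasurableSpace.comap (w t) inferInstance) μ := by
  have h := indep_iSup_of_disjoint (fun k => (hw k).comap_le)
    ((iIndepFun_iff_iIndep _ _ _).1 hindep) (S := Set.Iio t) (T := {t}) (by simp)
  simpa [past] using h

end Measurability

/-! ### The exponential potential and confidence failures -/

section Potential

variable {L : ℕ} {Ω : Type*} {w : ℕ → Ω → Fin L → unitInterval}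
  {oracle : (Fin L → ℝ) → Finset (Fin L)}

/-- The exponential increment of a weight observation. -/
noncomputable def expIncrement (l v x : ℝ) : ℝ :=
  Real.exp (l * (x - v) - l ^ 2 / 8)

/-- The exponential potential of the estimate of the item `e`; it is `1` as long as `e` is
unobserved. -/
noncomputable def potential (oracle : (Fin L → ℝ) → Finset (Fin L)) (w : ℕ → Fin L → ℝ)
    (e : Fin L) (l v : ℝ) (t : ℕ) : ℝ :=
  if initWeights oracle t e = 1 then 1
  else Real.exp (l * ((run oracle w t).T e * ((run oracle w t).wHat e - v))
    - l ^ 2 / 8 * (run oracle w t).T e)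

/-- The initialization overwrites estimates and keeps the counters at `1`, so a new observation
restarts the potential instead of multiplying it. -/
theorem potential_succ_of_initAt {w : ℕ → Fin L → ℝ} {e : Fin L} {l v : ℝ} {t : ℕ}
    (h : InitAt oracle t) :
    potential oracle w e l v (t + 1) =
      if e ∈ oracle (initWeights oracle t) then expIncrement l v (w t e)
      else potential oracle w e l v t := by
  have h' : ∃ e, initWeights oracle t e = 1 := h
  by_cases he : e ∈ oracle (initWeights oracle t)
  · simp [potential, run_succ_of_initAt h, he, initWeights, h', run_T_of_initAt h, expIncrement]
  · simp [potential, run_succ_of_initAt h, he, initWeights, h']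

open Classical in
theorem potential_succ_of_not_initAt {w : ℕ → Fin L → ℝ} {e : Fin L} {l v : ℝ} {t : ℕ}
    (h : ¬ InitAt oracle t) :
    potential oracle w e l v (t + 1) =
      if e ∈ chosen oracle w t then potential oracle w e l v t * expIncrement l v (w t e)
      else potential oracle w e l v t := by
  have h' : ¬ ∃ e, initWeights oracle t e = 1 := h
  have hu : initWeights oracle t e ≠ 1 := fun hu => h' ⟨e, hu⟩
  rw [potential, run_succ_of_not_initAt h, initWeights, if_neg h', if_neg hu, potential,
    if_neg hu]
  dsimp only
  split_ifs with he
  · rw [expIncrement, ← Real.exp_add]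
    congr 1
    have : ((run oracle w t).T e : ℝ) + 1 ≠ 0 := by positivity
    push_cast
    field_simp
    ring
  · rfl

/-- The confidence interval of the item `e` after `t` steps does not contain its mean weight. -/
def confidenceFailure (oracle : (Fin L → ℝ) → Finset (Fin L)) (w : ℕ → Ω → Fin L → unitInterval)
    (v : Fin L → ℝ) (t : ℕ) (e : Fin L) : Set Ω :=
  {ω | ¬ InitAt oracle t ∧ State.radius t ((run oracle (path w ω) t).T e)
    < |(run oracle (path w ω) t).wHat e - v e|}

/-- The optimal `l` depends on the random counter, while the potential is controlled for
deterministic `l` only; hence the union over all possible values `s`. The choice `l = ±4 * c` with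
`c = radius t s` and `s = T` turns a deviation above `c` into an exponent of at least `4 * c ^ 2 * T
- 2 * c ^ 2 * T = 3 * log t`. -/
theorem confidenceFailure_subset {v : Fin L → ℝ} {t : ℕ} (ht : 1 ≤ t) (e : Fin L) :
    confidenceFailure oracle w v t e ⊆ ⋃ s ∈ Finset.Icc 1 t,
      ({ω | 3 * Real.log t ≤ Real.log (potential oracle (path w ω) e
          (4 * State.radius t s) (v e) t)} ∪
        {ω | 3 * Real.log t ≤ Real.log (potential oracle (path w ω) e
          (-(4 * State.radius t s)) (v e) t)}) := by
  rintro ω ⟨hi, hω⟩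
  have hu : initWeights oracle t e ≠ 1 := fun hu => hi ⟨e, hu⟩
  set T := (run oracle (path w ω) t).T e with hT
  have hT1 : 1 ≤ T := one_le_run_T e
  refine Set.mem_biUnion (x := T) (Finset.mem_coe.2 (Finset.mem_Icc.2 ⟨hT1, run_T_le ht e⟩)) ?_
  have hTpos : (0 : ℝ) < T := by exact_mod_cast hT1
  have hc : 0 ≤ State.radius t T := Real.sqrt_nonneg _
  have hlog : 0 ≤ Real.log t := Real.log_natCast_nonneg t
  have hcsq : T * State.radius t T ^ 2 = 1.5 * Real.log t := by
    rw [State.radius, Real.sq_sqrt (by positivity)]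
    field_simp
  set c := State.radius t T
  rcases lt_abs.1 hω with h | h
  · left
    simp only [Set.mem_ofPred_eq, potential, if_neg hu, Real.log_exp, ← hT]
    have := mul_le_mul_of_nonneg_left h.le (mul_nonneg hc hTpos.le)
    nlinarith
  · right
    simp only [Set.mem_ofPred_eq, potential, if_neg hu, Real.log_exp, ← hT]
    have := mul_le_mul_of_nonneg_left h.le (mul_nonneg hc hTpos.le)
    nlinarith

end Potential

/-! ### Failure probabilities -/

section Concentration

open scoped ENNReal

variable {L : ℕ} {B : SemiBandit L} {Ω : Type*} [MeasurableSpace Ω] {μ : Measure Ω}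
  {w : ℕ → Ω → Fin L → unitInterval} {oracle : (Fin L → ℝ) → Finset (Fin L)} {Θ : Finset (Finset (Fin L))}

theorem integral_path_apply {t : ℕ} (hw : Measurable (w t)) (hlaw : μ.map (w t) = B.law)
    (e : Fin L) : ∫ ω, path w ω t e ∂μ = B.meanWeight e := by
  rw [SemiBandit.meanWeight, ← hlaw, integral_map hw.aemeasurable]
  · rfl
  · exact (measurable_subtype_coe.comp (measurable_pi_apply e)).aestronglyMeasurable

theorem measurable_potential (horacle : IsOracle Θ oracle) {t : ℕ}
    (hw : ∀ k < t, Measurable (w k)) (e : Fin L) (l v : ℝ) :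
    Measurable fun ω => potential oracle (path w ω) e l v t := by
  obtain ⟨hT, hW⟩ := measurable_run horacle hw e
  have hT' : Measurable fun ω => ((run oracle (path w ω) t).T e : ℝ) :=
    measurable_from_nat.comp hT
  unfold potential
  split_ifs
  · exact measurable_const
  · fun_prop

theorem measurableSet_confidenceFailure (horacle : IsOracle Θ oracle)
    (hw : ∀ t, Measurable (w t)) (v : Fin L → ℝ) (t : ℕ) (e : Fin L) :
    MeasurableSet (confidenceFailure oracle w v t e) := by
  obtain ⟨hT, hW⟩ := measurable_run horacle (fun k (_ : k < t) => hw k) e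
  have h : MeasurableSet {ω | State.radius t ((run oracle (path w ω) t).T e)
      < |(run oracle (path w ω) t).wHat e - v e|} := by
    refine measurableSet_lt ?_ (hW.sub_const _).abs
    exact (measurable_of_countable (State.radius t)).comp hT
  exact (MeasurableSet.const _).inter h

variable [IsProbabilityMeasure μ]

/-- Hoeffding's lemma: a weight in `[0,1]` is sub-Gaussian with variance proxy `1 / 4`, which the
term `l ^ 2 / 8` compensates exactly. -/
theorem lintegral_expIncrement_le_one {t : ℕ} (hw : Measurable (w t))
    (hlaw : μ.map (w t) = B.law) (e : Fin L) (l : ℝ) :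
    ∫⁻ ω, ENNReal.ofReal (expIncrement l (B.meanWeight e) (path w ω t e)) ∂μ ≤ 1 := by
  have hsub := hasSubgaussianMGF_of_mem_Icc (μ := μ) (a := 0) (b := 1)
    (measurable_path_apply hw e).aemeasurable (ae_of_all _ fun ω => (w t ω e).2)
  rw [integral_path_apply hw hlaw e] at hsub
  have hexp : ∀ ω, expIncrement l (B.meanWeight e) (path w ω t e)
      = Real.exp (l * (path w ω t e - B.meanWeight e)) * Real.exp (-(l ^ 2 / 8)) := fun ω => by
    rw [expIncrement, sub_eq_add_neg, Real.exp_add]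
  have hint : Integrable
      (fun ω => expIncrement l (B.meanWeight e) (path w ω t e)) μ := by
    simp only [hexp]
    exact (hsub.integrable_exp_mul l).mul_const _
  rw [← ofReal_integral_eq_lintegral_ofReal hint (ae_of_all _ fun ω => (Real.exp_pos _).le)]
  refine ENNReal.ofReal_le_one.2 ?_
  simp only [hexp]
  rw [integral_mul_const]
  have hmgf := hsub.mgf_le l
  rw [mgf] at hmgf
  calc _ ≤ _ := mul_le_mul_of_nonneg_right hmgf (Real.exp_pos _).le
    _ = 1 := by
      rw [← Real.exp_add, Real.exp_eq_one_iff]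
      simp
      ring

/-- The supermartingale argument. After the initialization the potential changes only if `e` is
chosen, an event of the past, and then it is multiplied by an independent factor of mean at most
`1`. Within the initialization the schedule is deterministic, so a restart also leaves mean at most
`1`. -/
theorem lintegral_potential_le_one (horacle : IsOracle Θ oracle)
    (hw : ∀ t, Measurable (w t)) (hlaw : ∀ t, μ.map (w t) = B.law) (hindep : iIndepFun w μ)
    (e : Fin L) (l : ℝ) (t : ℕ) :
    ∫⁻ ω, ENNReal.ofReal (potential oracle (path w ω) e l (B.meanWeight e) t) ∂μ ≤ 1 := by
  induction t with
  | zero => simp [potential, initWeights]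
  | succ t ih =>
    by_cases hi : InitAt oracle t
    · simp only [potential_succ_of_initAt hi]
      split_ifs
      exacts [lintegral_expIncrement_le_one (hw t) (hlaw t) e l, ih]
    · set S : Set Ω := {ω | e ∈ chosen oracle (path w ω) t} with hS_def
      have hS : MeasurableSet S := measurableSet_chosen horacle (fun k _ => hw k) (e ∈ ·)
      -- Measurability is needed a second time with respect to the past, to apply independence from
      -- `w t`.
      have hS' : MeasurableSet[past w t] S :=
        @measurableSet_chosen _ _ _ _ _ (past w t) horacle _ (fun k hk => measurable_past hk)
          (e ∈ ·)
      set Z : Ω → ℝ≥0∞ := fun ω =>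
        ENNReal.ofReal (potential oracle (path w ω) e l (B.meanWeight e) t)
      have hZ' : Measurable[past w t] Z :=
        ENNReal.measurable_ofReal.comp (@measurable_potential _ _ (past w t) _ _ _ horacle _
          (fun k hk => measurable_past hk) e l (B.meanWeight e))
      set g : Ω → ℝ≥0∞ := fun ω =>
        ENNReal.ofReal (expIncrement l (B.meanWeight e) (path w ω t e))
      have hg : Measurable[MeasurableSpace.comap (w t) inferInstance] g := by
        have h1 : Measurable[MeasurableSpace.comap (w t) inferInstance] (w t) :=
          comap_measurable _
        have h2 := @measurable_path_apply _ _ _ (MeasurableSpace.comap (w t) inferInstance) t h1 e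
        have h3 : Measurable fun x => ENNReal.ofReal (expIncrement l (B.meanWeight e) x) := by
          unfold expIncrement
          fun_prop
        exact h3.comp h2
      have hprod := lintegral_mul_eq_lintegral_mul_lintegral_of_independent_measurableSpace
        (past_le hw t) (hw t).comap_le (indep_past hw hindep t) (hZ'.indicator hS') hg
      calc ∫⁻ ω, ENNReal.ofReal (potential oracle (path w ω) e l (B.meanWeight e) (t + 1)) ∂μ
          = ∫⁻ ω in S, ENNReal.ofReal
                (potential oracle (path w ω) e l (B.meanWeight e) (t + 1)) ∂μ
              + ∫⁻ ω in Sᶜ, ENNReal.ofReal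
                (potential oracle (path w ω) e l (B.meanWeight e) (t + 1)) ∂μ :=
            (lintegral_add_compl _ hS).symm
        _ = ∫⁻ ω, S.indicator Z ω * g ω ∂μ + ∫⁻ ω in Sᶜ, Z ω ∂μ := by
            congr 1
            · rw [← lintegral_indicator hS]
              refine lintegral_congr fun ω => ?_
              by_cases hω : ω ∈ S
              · rw [Set.indicator_of_mem hω, Set.indicator_of_mem hω]
                rw [hS_def, Set.mem_ofPred_eq] at hω
                rw [potential_succ_of_not_initAt hi, if_pos hω, ENNReal.ofReal_mul]
                rw [potential]
                split_ifs <;> positivity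
              · simp [hω]
            · refine setLIntegral_congr_fun hS.compl fun ω hω => ?_
              rw [Set.mem_compl_iff, hS_def, Set.mem_ofPred_eq] at hω
              rw [potential_succ_of_not_initAt hi, if_neg hω]
        _ ≤ (∫⁻ ω in S, Z ω ∂μ) * 1 + ∫⁻ ω in Sᶜ, Z ω ∂μ := by
            rw [hprod, lintegral_indicator hS]
            gcongr
            exact lintegral_expIncrement_le_one (hw t) (hlaw t) e l
        _ ≤ 1 := by
            rw [mul_one, lintegral_add_compl _ hS]
            exact ih

theorem measure_potential_tail_le (horacle : IsOracle Θ oracle)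
    (hw : ∀ t, Measurable (w t)) (hlaw : ∀ t, μ.map (w t) = B.law) (hindep : iIndepFun w μ)
    (e : Fin L) (l a : ℝ) (t : ℕ) :
    μ {ω | a ≤ Real.log (potential oracle (path w ω) e l (B.meanWeight e) t)}
      ≤ ENNReal.ofReal (Real.exp (-a)) := by
  have hpos : ∀ ω, 0 < potential oracle (path w ω) e l (B.meanWeight e) t := fun ω => by
    rw [potential]
    split_ifs <;> positivity
  have hmarkov := (mul_meas_ge_le_lintegral (μ := μ) (measurable_potential horacle
    (fun k _ => hw k) e l (B.meanWeight e) (t := t)).ennreal_ofReal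
    (ENNReal.ofReal (Real.exp a))).trans
      (lintegral_potential_le_one horacle hw hlaw hindep e l t)
  have hset : {ω | a ≤ Real.log (potential oracle (path w ω) e l (B.meanWeight e) t)}
      = {ω | ENNReal.ofReal (Real.exp a)
          ≤ ENNReal.ofReal (potential oracle (path w ω) e l (B.meanWeight e) t)} := by
    ext ω
    rw [Set.mem_ofPred_eq, Set.mem_ofPred_eq, Real.le_log_iff_exp_le (hpos ω),
      ENNReal.ofReal_le_ofReal_iff (hpos ω).le]
  rw [hset, Real.exp_neg, ENNReal.ofReal_inv_of_pos (Real.exp_pos a), ← one_div,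
    ENNReal.le_div_iff_mul_le (Or.inl (by simp [Real.exp_pos])) (Or.inl ENNReal.ofReal_ne_top),
    mul_comm]
  exact hmarkov

/-- Markov's inequality at level `3 * log t` gives `t ^ (-3)` for each sign and each of the `t`
counter values. -/
theorem measureReal_confidenceFailure_le (horacle : IsOracle Θ oracle)
    (hw : ∀ t, Measurable (w t)) (hlaw : ∀ t, μ.map (w t) = B.law) (hindep : iIndepFun w μ)
    (t : ℕ) (e : Fin L) :
    μ.real (confidenceFailure oracle w B.meanWeight t e) ≤ 2 * (1 / (t : ℝ) ^ 2) := by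
  rcases Nat.eq_zero_or_pos t with rfl | ht
  · have : confidenceFailure oracle w B.meanWeight 0 e = ∅ :=
      Set.eq_empty_of_forall_notMem fun ω hω => hω.1 ⟨e, rfl⟩
    simp [this]
  have ht' : (0 : ℝ) < t := by exact_mod_cast ht
  have htail : ∀ l, μ.real {ω | 3 * Real.log t ≤ Real.log (potential oracle (path w ω) e
      l (B.meanWeight e) t)} ≤ 1 / (t : ℝ) ^ 3 := fun l => by
    refine ENNReal.toReal_le_of_le_ofReal (by positivity)
      ((measure_potential_tail_le horacle hw hlaw hindep e l _ t).trans_eq ?_)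
    rw [Real.exp_neg, ← Nat.cast_ofNat (n := 3), Real.exp_nat_mul, Real.exp_log ht', one_div]
  calc μ.real (confidenceFailure oracle w B.meanWeight t e)
      ≤ μ.real _ := measureReal_mono (confidenceFailure_subset ht e) (measure_ne_top _ _)
    _ ≤ ∑ s ∈ Finset.Icc 1 t, μ.real _ := measureReal_biUnion_finset_le _ _
    _ ≤ ∑ s ∈ Finset.Icc 1 t, (1 / (t : ℝ) ^ 3 + 1 / (t : ℝ) ^ 3) :=
        Finset.sum_le_sum fun s _ =>
          (measureReal_union_le _ _).trans (add_le_add (htail _) (htail _))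
    _ = 2 * (1 / (t : ℝ) ^ 2) := by
        rw [Finset.sum_const, Nat.card_Icc, nsmul_eq_mul, Nat.add_sub_cancel]
        field_simp
        ring

theorem sum_measureReal_confidenceFailure_le (horacle : IsOracle Θ oracle)
    (hw : ∀ t, Measurable (w t)) (hlaw : ∀ t, μ.map (w t) = B.law) (hindep : iIndepFun w μ)
    (n : ℕ) (e : Fin L) :
    ∑ t ∈ Finset.range n, μ.real (confidenceFailure oracle w B.meanWeight t e)
      ≤ Real.pi ^ 2 / 3 := by
  calc _ ≤ ∑ t ∈ Finset.range n, 2 * (1 / (t : ℝ) ^ 2) := Finset.sum_le_sum fun t _ =>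
        measureReal_confidenceFailure_le horacle hw hlaw hindep t e
    _ ≤ 2 * (Real.pi ^ 2 / 6) := by
        rw [← Finset.mul_sum]
        exact mul_le_mul_of_nonneg_left
          (sum_le_hasSum _ (fun t _ => by positivity) hasSum_zeta_two) zero_le_two
    _ = Real.pi ^ 2 / 3 := by ring

end Concentration

/-! ### From gaps to regret -/

section Regret

variable {L : ℕ} {B : SemiBandit L} {oracle : (Fin L → ℝ) → Finset (Fin L)}
  {Aopt : Finset (Fin L)} {Ω : Type*} {w : ℕ → Ω → Fin L → unitInterval}

theorem SemiBandit.meanWeight_mem_Icc (B : SemiBandit L) (e : Fin L) :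
    B.meanWeight e ∈ Set.Icc (0 : ℝ) 1 := by
  have := B.isProbabilityMeasure_law
  refine ⟨integral_nonneg fun x => (x e).2.1, ?_⟩
  have h := integral_mono_of_nonneg (μ := B.law) (f := fun x => (x e : ℝ)) (g := fun _ => 1)
    (ae_of_all _ fun x => (x e).2.1) (integrable_const _) (ae_of_all _ fun x => (x e).2.2)
  simpa [SemiBandit.meanWeight] using h

theorem SemiBandit.card_le_maxCard {A : Finset (Fin L)} (hA : A ∈ B.feasible) :
    A.card ≤ B.maxCard :=
  Finset.le_sup (f := Finset.card) hA

theorem SemiBandit.gap_le_maxCard (hA : Aopt ∈ B.feasible) (A : Finset (Fin L)) :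
    B.gap Aopt A ≤ B.maxCard := by
  have h1 : 0 ≤ ret A B.meanWeight := Finset.sum_nonneg fun e _ => (B.meanWeight_mem_Icc e).1
  have h2 : ret Aopt B.meanWeight ≤ Aopt.card :=
    (Finset.sum_le_sum fun e _ => (B.meanWeight_mem_Icc e).2).trans_eq (by simp)
  have h3 : (Aopt.card : ℝ) ≤ B.maxCard := by exact_mod_cast B.card_le_maxCard hA
  rw [SemiBandit.gap]
  linarith

theorem SemiBandit.gap_eq_zero (hAopt : B.IsOptimal Aopt) {A : Finset (Fin L)}
    (hA : B.IsOptimal A) : B.gap Aopt A = 0 :=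
  sub_eq_zero.2 (le_antisymm (hA.2 _ hAopt.1) (hAopt.2 _ hA.1))

theorem radius_mono {t n : ℕ} (h : t ≤ n) (s : ℕ) :
    State.radius t s ≤ √(1.5 * Real.log n / s) := by
  rw [State.radius]
  rcases Nat.eq_zero_or_pos t with rfl | ht
  -- Here `Real.log 0 = 0`, so the radius is `0`.
  · simpa only [Nat.cast_zero, Real.log_zero, mul_zero, zero_div, Real.sqrt_zero] using
      Real.sqrt_nonneg _
  · have : (0 : ℝ) < t := by exact_mod_cast ht
    gcongr

theorem excess_nonneg (C d : ℝ) (s : ℕ) : 0 ≤ excess C d s :=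
  le_max_left _ _

/-- A threshold inequality for a sum of confidence radii is inflated to make every large counter
irrelevant. -/
theorem le_sum_excess {A : Finset (Fin L)} {K : ℕ} (hA : A.card ≤ K) {Δ C : ℝ} (hΔ : 0 ≤ Δ)
    {T : Fin L → ℕ} (h : Δ ≤ 2 * ∑ e ∈ A, √(C / T e)) :
    Δ ≤ ∑ e ∈ A, excess C (Δ / K) (T e) := by
  -- Doubling `h` leaves one spare `Δ`, enough to subtract a share `Δ / K` from each of the at most
  -- `K` items. For `K = 0` the share is `0` by the convention for division.
  have h1 : A.card * (Δ / K) ≤ Δ := by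
    rcases Nat.eq_zero_or_pos K with rfl | hK
    · simpa using hΔ
    · have hK' : (0 : ℝ) < K := by exact_mod_cast hK
      rw [mul_div_assoc', div_le_iff₀ hK', mul_comm]
      gcongr
  have h2 : ∑ e ∈ A, (4 * √(C / T e) - Δ / K) ≤ ∑ e ∈ A, excess C (Δ / K) (T e) :=
    Finset.sum_le_sum fun e _ => le_max_right _ _
  rw [Finset.sum_sub_distrib, ← Finset.mul_sum, Finset.sum_const, nsmul_eq_mul] at h2
  linarith

-- The three summands are the three accounts. All are nonnegative, so in each case one of them alone
-- pays for the gap: the first two by `gap ≤ K`, the last by optimism, with the radius enlarged to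
-- the horizon `n` so that it depends on the counter alone.
open Classical in
theorem gap_chosen_le (horacle : IsOracle B.feasible oracle) (hAopt : B.IsOptimal Aopt)
    {Δ : ℝ} (hΔ : 0 < Δ)
    (hgap : ∀ A ∈ B.feasible, ¬ B.IsOptimal A → B.gap Aopt A = Δ) {t n : ℕ} (htn : t ≤ n)
    (ω : Ω) :
    B.gap Aopt (chosen oracle (path w ω) t) ≤
      (if InitAt oracle t then (B.maxCard : ℝ) else 0) +
      B.maxCard *
        ∑ e, (confidenceFailure oracle w B.meanWeight t e).indicator (fun _ => (1 : ℝ)) ω +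
      (if InitAt oracle t then 0 else ∑ e ∈ chosen oracle (path w ω) t,
        excess (1.5 * Real.log n) (Δ / B.maxCard) ((run oracle (path w ω) t).T e)) := by
  have hK := B.gap_le_maxCard hAopt.1 (chosen oracle (path w ω) t)
  have hind : ∀ e, 0 ≤
      (confidenceFailure oracle w B.meanWeight t e).indicator (fun _ => (1 : ℝ)) ω := fun e =>
    Set.indicator_nonneg (fun _ _ => zero_le_one) ω
  have hsum := Finset.sum_nonneg fun e (_ : e ∈ Finset.univ) => hind e
  have hsum' := mul_nonneg (Nat.cast_nonneg (α := ℝ) B.maxCard) hsum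
  by_cases hi : InitAt oracle t
  · rw [if_pos hi, if_pos hi]
    linarith
  rw [if_neg hi, if_neg hi, zero_add]
  have hex : 0 ≤ ∑ e ∈ chosen oracle (path w ω) t,
      excess (1.5 * Real.log n) (Δ / B.maxCard) ((run oracle (path w ω) t).T e) :=
    Finset.sum_nonneg fun e _ => excess_nonneg _ _ _
  by_cases hbad : ∃ e, ω ∈ confidenceFailure oracle w B.meanWeight t e
  · obtain ⟨e, he⟩ := hbad
    have h1 := Finset.single_le_sum (fun e _ => hind e) (Finset.mem_univ e)
    rw [Set.indicator_of_mem he] at h1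
    have := mul_le_mul_of_nonneg_left h1 (Nat.cast_nonneg (α := ℝ) B.maxCard)
    linarith
  push Not at hbad
  by_cases hopt : B.IsOptimal (chosen oracle (path w ω) t)
  · rw [B.gap_eq_zero hAopt hopt]
    positivity
  have hmem : chosen oracle (path w ω) t ∈ B.feasible := chosen_mem horacle
  have hgood := ret_sub_ret_chosen_le horacle hAopt.1 hi (w := path w ω) (v := B.meanWeight)
    fun e => not_lt.1 fun h => hbad e ⟨hi, h⟩
  have hΔle : Δ ≤ 2 * ∑ e ∈ chosen oracle (path w ω) t,
      √(1.5 * Real.log n / (run oracle (path w ω) t).T e) := by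
    rw [← hgap _ hmem hopt]
    exact hgood.trans (mul_le_mul_of_nonneg_left
      (Finset.sum_le_sum fun e _ => radius_mono htn _) zero_le_two)
  have := le_sum_excess (B.card_le_maxCard hmem) hΔ.le hΔle
  rw [hgap _ hmem hopt]
  linarith

open Classical in
theorem sum_gap_chosen_le (horacle : IsOracle B.feasible oracle)
    (hcover : ∀ e : Fin L, ∃ A ∈ B.feasible, e ∈ A) (hAopt : B.IsOptimal Aopt)
    {Δ : ℝ} (hΔ : 0 < Δ)
    (hgap : ∀ A ∈ B.feasible, ¬ B.IsOptimal A → B.gap Aopt A = Δ) (n : ℕ) (ω : Ω) :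
    ∑ t ∈ Finset.range n, B.gap Aopt (chosen oracle (path w ω) t) ≤
      B.maxCard * L + L * (B.maxCard * (48 * Real.log n) / Δ) + B.maxCard *
        ∑ e, ∑ t ∈ Finset.range n,
          (confidenceFailure oracle w B.meanWeight t e).indicator (fun _ => (1 : ℝ)) ω := by
  have hle := Finset.sum_le_sum (s := Finset.range n) fun t ht => gap_chosen_le (w := w) horacle hAopt hΔ hgap
    (Finset.mem_range.1 ht).le ω
  rw [Finset.sum_add_distrib, Finset.sum_add_distrib, sum_sum_chosen_le, ← Finset.mul_sum,
    Finset.sum_comm, ← Finset.sum_filter, Finset.sum_const, nsmul_eq_mul] at hle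
  have hinit : (((Finset.range n).filter (InitAt oracle)).card : ℝ) ≤ L := by
    exact_mod_cast card_filter_initAt_le horacle hcover n
  have h1 := mul_le_mul_of_nonneg_right hinit (Nat.cast_nonneg (α := ℝ) B.maxCard)
  have h2 : ∑ e, ∑ s ∈ Finset.Ico 1 ((run oracle (path w ω) n).T e),
      excess (1.5 * Real.log n) (Δ / B.maxCard) s
        ≤ ∑ _e : Fin L, B.maxCard * (48 * Real.log n) / Δ := by
    refine Finset.sum_le_sum fun e _ => ?_
    obtain ⟨A, hA, heA⟩ := hcover e
    have hK : (0 : ℝ) < B.maxCard := by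
      exact_mod_cast (Finset.card_pos.2 ⟨e, heA⟩).trans_le (B.card_le_maxCard hA)
    have hlog : 0 ≤ Real.log n := Real.log_natCast_nonneg n
    -- The constant is `32 * 1.5 = 48`.
    refine (sum_excess_le (by positivity) (by positivity) _).trans_eq ?_
    field_simp
    ring
  rw [Finset.sum_const, Finset.card_univ, Fintype.card_fin, nsmul_eq_mul] at h2
  linarith

open Classical in
theorem ret_eq_sum_indicator (A : Ω → Finset (Fin L)) (x : Ω → Fin L → ℝ) (ω : Ω) :
    ret (A ω) (x ω) = ∑ e, {ω | e ∈ A ω}.indicator (fun ω => x ω e) ω := by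
  simp [ret, Set.indicator_apply]

variable [MeasurableSpace Ω] {μ : Measure Ω}

/-- Whether `e` is chosen is decided by the past, which is independent of the current weights, so
the expectation factorizes. -/
theorem integral_indicator_chosen {Θ : Finset (Finset (Fin L))} (horacle : IsOracle Θ oracle)
    (hw : ∀ t, Measurable (w t)) (hlaw : ∀ t, μ.map (w t) = B.law) (hindep : iIndepFun w μ)
    (t : ℕ) (e : Fin L) :
    ∫ ω, {ω | e ∈ chosen oracle (path w ω) t}.indicator (fun ω => path w ω t e) ω ∂μ
      = μ.real {ω | e ∈ chosen oracle (path w ω) t} * B.meanWeight e := by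
  set S : Set Ω := {ω | e ∈ chosen oracle (path w ω) t}
  have hS : MeasurableSet S := measurableSet_chosen horacle (fun k _ => hw k) (e ∈ ·)
  have hS' : MeasurableSet[past w t] S :=
    @measurableSet_chosen _ _ _ _ _ (past w t) horacle _ (fun k hk => measurable_past hk) (e ∈ ·)
  have h1 : Measurable[past w t] (S.indicator (1 : Ω → ℝ)) :=
    (@measurable_const _ _ _ (past w t) (1 : ℝ)).indicator hS'
  have h2 : Measurable[MeasurableSpace.comap (w t) inferInstance] fun ω => path w ω t e :=
    @measurable_path_apply _ _ _ (MeasurableSpace.comap (w t) inferInstance) t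
      (comap_measurable _) e
  have hind : IndepFun (S.indicator (1 : Ω → ℝ)) (fun ω => path w ω t e) μ := by
    rw [IndepFun_iff_Indep]
    exact indep_of_indep_of_le_left (indep_of_indep_of_le_right (indep_past hw hindep t)
      h2.comap_le) h1.comap_le
  have h := hind.integral_mul_eq_mul_integral
    (h1.mono (past_le hw t) le_rfl).aestronglyMeasurable
    (measurable_path_apply (hw t) e).aestronglyMeasurable
  rw [integral_indicator_one hS, integral_path_apply (hw t) (hlaw t) e] at h
  rw [← h]
  refine integral_congr_ae (ae_of_all _ fun ω => ?_)
  by_cases hω : ω ∈ S <;> simp [hω]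

variable [IsProbabilityMeasure μ]

theorem integrable_path_apply {t : ℕ} (hw : Measurable (w t)) (e : Fin L) :
    Integrable (fun ω => path w ω t e) μ :=
  Integrable.of_mem_Icc 0 1 (measurable_path_apply hw e).aemeasurable
    (ae_of_all _ fun ω => (w t ω e).2)

theorem integrable_ret_chosen {Θ : Finset (Finset (Fin L))} (horacle : IsOracle Θ oracle)
    (hw : ∀ t, Measurable (w t)) (t : ℕ) :
    Integrable (fun ω => ret (chosen oracle (path w ω) t) (path w ω t)) μ := by
  simp only [ret_eq_sum_indicator (fun ω => chosen oracle (path w ω) t) fun ω => path w ω t]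
  exact integrable_finsetSum _ fun e _ => (integrable_path_apply (hw t) e).indicator
    (measurableSet_chosen horacle (fun k _ => hw k) (e ∈ ·))

theorem integrable_ret_chosen_mean {Θ : Finset (Finset (Fin L))} (horacle : IsOracle Θ oracle)
    (hw : ∀ t, Measurable (w t)) (v : Fin L → ℝ) (t : ℕ) :
    Integrable (fun ω => ret (chosen oracle (path w ω) t) v) μ := by
  simp only [ret_eq_sum_indicator (fun ω => chosen oracle (path w ω) t) fun _ => v]
  exact integrable_finsetSum _ fun e _ => (integrable_const (v e)).indicator
    (measurableSet_chosen horacle (fun k _ => hw k) (e ∈ ·))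

theorem integral_ret_chosen {Θ : Finset (Finset (Fin L))} (horacle : IsOracle Θ oracle)
    (hw : ∀ t, Measurable (w t)) (hlaw : ∀ t, μ.map (w t) = B.law) (hindep : iIndepFun w μ)
    (t : ℕ) :
    ∫ ω, ret (chosen oracle (path w ω) t) (path w ω t) ∂μ
      = ∫ ω, ret (chosen oracle (path w ω) t) B.meanWeight ∂μ := by
  have hS : ∀ e, MeasurableSet {ω | e ∈ chosen oracle (path w ω) t} := fun e =>
    measurableSet_chosen horacle (fun k _ => hw k) (e ∈ ·)
  simp only [ret_eq_sum_indicator (fun ω => chosen oracle (path w ω) t) fun ω => path w ω t,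
    ret_eq_sum_indicator (fun ω => chosen oracle (path w ω) t) fun _ => B.meanWeight]
  rw [integral_finsetSum _ fun e _ => (integrable_path_apply (hw t) e).indicator (hS e),
    integral_finsetSum _ fun e _ => (integrable_const _).indicator (hS e)]
  refine Finset.sum_congr rfl fun e _ => ?_
  rw [integral_indicator_chosen horacle hw hlaw hindep, integral_indicator_const _ (hS e),
    smul_eq_mul]

theorem integrable_ret (hw : ∀ t, Measurable (w t)) (A : Finset (Fin L)) (t : ℕ) :
    Integrable (fun ω => ret A (path w ω t)) μ :=
  integrable_finsetSum _ fun e _ => integrable_path_apply (hw t) e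

theorem integrable_ret_sub_ret_chosen {Θ : Finset (Finset (Fin L))}
    (horacle : IsOracle Θ oracle) (hw : ∀ t, Measurable (w t)) (t : ℕ) :
    Integrable (fun ω => ret Aopt (path w ω t)
      - ret (chosen oracle (path w ω) t) (path w ω t)) μ :=
  (integrable_ret hw Aopt t).sub (integrable_ret_chosen horacle hw t)

theorem integrable_cumRegret {Θ : Finset (Finset (Fin L))} (horacle : IsOracle Θ oracle)
    (hw : ∀ t, Measurable (w t)) (n : ℕ) :
    Integrable (fun ω => cumRegret oracle Aopt (path w ω) n) μ :=
  integrable_finsetSum _ fun t _ => integrable_ret_sub_ret_chosen horacle hw t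

theorem integrable_gap_chosen {Θ : Finset (Finset (Fin L))} (horacle : IsOracle Θ oracle)
    (hw : ∀ t, Measurable (w t)) (t : ℕ) :
    Integrable (fun ω => B.gap Aopt (chosen oracle (path w ω) t)) μ :=
  (integrable_const _).sub (integrable_ret_chosen_mean horacle hw _ t)

theorem integral_cumRegret {Θ : Finset (Finset (Fin L))} (horacle : IsOracle Θ oracle)
    (hw : ∀ t, Measurable (w t)) (hlaw : ∀ t, μ.map (w t) = B.law) (hindep : iIndepFun w μ)
    (n : ℕ) :
    ∫ ω, cumRegret oracle Aopt (path w ω) n ∂μ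
      = ∫ ω, ∑ t ∈ Finset.range n, B.gap Aopt (chosen oracle (path w ω) t) ∂μ := by
  unfold cumRegret
  rw [integral_finsetSum _ fun t _ => integrable_ret_sub_ret_chosen horacle hw t,
    integral_finsetSum _ fun t _ => integrable_gap_chosen horacle hw t]
  refine Finset.sum_congr rfl fun t _ => ?_
  have hA : ∫ ω, ret Aopt (path w ω t) ∂μ = ret Aopt B.meanWeight := by
    unfold ret
    rw [integral_finsetSum _ fun e _ => integrable_path_apply (hw t) e]
    exact Finset.sum_congr rfl fun e _ => integral_path_apply (hw t) (hlaw t) e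
  unfold SemiBandit.gap
  rw [integral_sub (integrable_ret hw Aopt t) (integrable_ret_chosen horacle hw t),
    integral_sub (integrable_const _) (integrable_ret_chosen_mean horacle hw _ t), hA,
    integral_ret_chosen horacle hw hlaw hindep]
  simp

theorem integral_cumRegret_le (horacle : IsOracle B.feasible oracle)
    (hcover : ∀ e : Fin L, ∃ A ∈ B.feasible, e ∈ A) (hAopt : B.IsOptimal Aopt)
    {Δ : ℝ} (hΔ : 0 < Δ)
    (hgap : ∀ A ∈ B.feasible, ¬ B.IsOptimal A → B.gap Aopt A = Δ)
    (hw : ∀ t, Measurable (w t)) (hlaw : ∀ t, μ.map (w t) = B.law) (hindep : iIndepFun w μ)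
    (n : ℕ) :
    ∫ ω, cumRegret oracle Aopt (path w ω) n ∂μ ≤
      B.maxCard * L + L * (B.maxCard * (48 * Real.log n) / Δ)
        + B.maxCard * (L * (Real.pi ^ 2 / 3)) := by
  have hF := measurableSet_confidenceFailure horacle hw B.meanWeight
  have hint : ∀ e t, Integrable
      ((confidenceFailure oracle w B.meanWeight t e).indicator fun _ => (1 : ℝ)) μ :=
    fun e t => (integrable_const 1).indicator (hF t e)
  have hint' : Integrable (fun ω => ∑ e, ∑ t ∈ Finset.range n,
      (confidenceFailure oracle w B.meanWeight t e).indicator (fun _ => (1 : ℝ)) ω) μ :=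
    integrable_finsetSum _ fun e _ => integrable_finsetSum _ fun t _ => hint e t
  rw [integral_cumRegret (B := B) horacle hw hlaw hindep]
  refine (integral_mono (integrable_finsetSum _ fun t _ => integrable_gap_chosen horacle hw t)
    ((integrable_const _).add (hint'.const_mul _))
    (sum_gap_chosen_le horacle hcover hAopt hΔ hgap n)).trans ?_
  simp only [Pi.add_apply]
  rw [integral_add (integrable_const _) (hint'.const_mul _), integral_const, probReal_univ,
    one_smul, integral_const_mul, integral_finsetSum _ fun e _ =>
      integrable_finsetSum _ fun t _ => hint e t]
  have hsum : ∀ e, ∫ ω, ∑ t ∈ Finset.range n,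
      (confidenceFailure oracle w B.meanWeight t e).indicator (fun _ => (1 : ℝ)) ω ∂μ
        ≤ Real.pi ^ 2 / 3 := fun e => by
    rw [integral_finsetSum _ fun t _ => hint e t]
    simp only [integral_indicator_const _ (hF _ e), smul_eq_mul, mul_one]
    exact sum_measureReal_confidenceFailure_le horacle hw hlaw hindep n e
  gcongr
  exact (Finset.sum_le_sum fun e _ => hsum e).trans_eq (by simp)

end Regret

end CombSemiBandit

/-! ### The regret bound -/

theorem mainTheorem5 {L : ℕ} (B : CombSemiBandit.SemiBandit L)
    (hcover : ∀ e : Fin L, ∃ A ∈ B.feasible, e ∈ A)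
    (oracle : (Fin L → ℝ) → Finset (Fin L))
    (horacle : CombSemiBandit.IsOracle B.feasible oracle)
    (Aopt : Finset (Fin L)) (hAopt : B.IsOptimal Aopt)
    (Δ : ℝ) (hΔ : 0 < Δ)
    (hgap : ∀ A ∈ B.feasible, ¬ B.IsOptimal A → B.gap Aopt A = Δ)
    {Ω : Type*} [MeasurableSpace Ω] (μ : Measure Ω) [IsProbabilityMeasure μ]
    (w : ℕ → Ω → Fin L → unitInterval)
    (hw_meas : ∀ t, Measurable (w t))
    (hw_law : ∀ t, μ.map (w t) = B.law)
    (hw_indep : iIndepFun w μ)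
    (n : ℕ) :
    Integrable
        (fun ω => CombSemiBandit.cumRegret oracle Aopt (fun t e => (w t ω e : ℝ)) n) μ ∧
      ∫ ω, CombSemiBandit.cumRegret oracle Aopt (fun t e => (w t ω e : ℝ)) n ∂μ ≤
        (B.maxCard : ℝ) * L * (267 / Δ) * Real.log n +
          (Real.pi ^ 2 / 3 + 1) * B.maxCard * L := by
  refine ⟨CombSemiBandit.integrable_cumRegret horacle hw_meas n,
    (CombSemiBandit.integral_cumRegret_le horacle hcover hAopt hΔ hgap hw_meas hw_law hw_indep
      n).trans ?_⟩
  have hlog : 0 ≤ Real.log n := Real.log_natCast_nonneg n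
  -- The slack between the two constants: `219 = 267 - 48`.
  have h : (0 : ℝ) ≤ B.maxCard * L * (219 / Δ) * Real.log n := by positivity
  have heq : (B.maxCard : ℝ) * L * (267 / Δ) * Real.log n =
      L * (B.maxCard * (48 * Real.log n) / Δ) + B.maxCard * L * (219 / Δ) * Real.log n := by
    ring
  rw [heq]
  linarith
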